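/- Let $K$ be a field and let $l,m,s,t$ be non-negative integers with $m=tl+s$, $0\le s<l$ and $t\ge 2$. A run of length $r\ge 1$ is a simplicial complex on $(r-1)l+m$ distinct vertices $x_1,\dots,x_{(r-1)l+m}$ whose facets are the $r$ sets $F_i=\{x_{(i-1)l+1},\dots,x_{(i-1)l+m}\}$, $1\le i\le r$. Let $\alpha,\beta\ge 0$ be integers with $\alpha+\beta\ge 1$, let $p_1,\dots,p_\alpha,q_1,\dots,q_\beta\ge 0$ be integers, and put $P=\sum_{a=1}^{\alpha}p_a$ and $Q=\sum_{b=1}^{\beta}q_b$. Let $\Gamma$ be a disjoint union (with pairwise disjoint vertex sets) of runs of lengths $p_1(t+1)+1,\dots,p_\alpha(t+1)+1,\ q_1(t+1)+2,\dots,q_\beta(t+1)+2$; for instance, an induced subcollection, whose connected components are runs of these lengths, of the path complex with facets $\{x_{(i-1)l+1},\dots,x_{(i-1)l+m}\}$, $1\le i\le n/l$ (indices modulo $n$), of a cycle with $n$ vertices $x_1,\dots,x_n$, where $l\mid n$. Let $V(\Gamma)$ be the vertex set of $\Gamma$ and let $\mathcal E$ be the simplicial complex generated by the sets $V(\Gamma)\setminus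 F$, where $F$ runs over the facets of $\Gamma$. Then for every integer $i$ the reduced simplicial homology of $\mathcal E$ with coefficients in $K$ is $$\widetilde H_i(\mathcal E)\cong\begin{cases}K,&\text{if } i=2(P+Q)+2\beta+\alpha-2,\\ 0,&\text{otherwise.}\end{cases}$$ -/

import Mathlib

set_option maxSynthPendingDepth 3

namespace PathComplexes

/-- An abstract simplicial complex with vertices in `V`: a collection of finite sets closed under
taking subsets. The empty face is allowed, so that the complex `{∅}` differs from the complex
without faces. -/
@[ext]
structure SimplicialComplex (V : Type*) where
  faces : Set (Finset V)
  down_closed : ∀ ⦃F G : Finset V⦄, F ∈ faces → G ⊆ F → G ∈ faces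

namespace SimplicialComplex

variable {V : Type*}

/-- The facets: the maximal faces under inclusion. -/
def facets (D : SimplicialComplex V) : Set (Finset V) := {F | Maximal (fun G => G ∈ D.faces) F}

/-- The vertex set `V(Δ)`. -/
def vertexSet (D : SimplicialComplex V) : Set V := {v | {v} ∈ D.faces}

/-- `⟨F | F ∈ S⟩`: the complex whose faces are the finite subsets of the members of `S`. -/
def generated (S : Set (Set V)) : SimplicialComplex V where
  faces := {G | ∃ F ∈ S, (G : Set V) ⊆ F}
  down_closed := by
    rintro F G ⟨H, hH, hF⟩ hG
    exact ⟨H, hH, fun _ hx => hF (hG hx)⟩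

/-- The complement `Δ_Y^c = ⟨Y \ F | F a facet of Δ⟩`. -/
def complement (D : SimplicialComplex V) (Y : Set V) : SimplicialComplex V :=
  generated {G | ∃ F ∈ D.facets, G = Y \ (F : Set V)}

section Homology

variable (K : Type*) [Field K] [LinearOrder V]

/-- The simplicial boundary map for the orientation given by the order of the vertices,
`∂ σ = ∑_{v ∈ σ} (-1)^{#{w ∈ σ | w < v}} (σ \ {v})`; in particular `∂ {v} = ∅` (the augmentation)
and `∂ ∅ = 0`. -/
noncomputable def boundary : (Finset V →₀ K) →ₗ[K] (Finset V →₀ K) :=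
  Finsupp.lsum K fun σ => LinearMap.toSpanSingleton K (Finset V →₀ K)
    (∑ v ∈ σ, Finsupp.single (σ.erase v) ((-1 : K) ^ (σ.filter (fun w => w < v)).card))

/-- The reduced `i`-chains: combinations of the faces with `i + 1` elements (`i = -1` gives the
empty face, and there are no chains in degrees below `-1`). -/
def chains (D : SimplicialComplex V) (i : ℤ) : Submodule K (Finset V →₀ K) :=
  Finsupp.supported K K {σ | σ ∈ D.faces ∧ (σ.card : ℤ) = i + 1}

/-- The reduced `i`-cycles `Z_i`. -/
noncomputable def cycles (D : SimplicialComplex V) (i : ℤ) : Submodule K (Finset V →₀ K) :=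
  D.chains K i ⊓ LinearMap.ker (boundary K)

/-- The reduced `i`-boundaries `B_i`. -/
noncomputable def boundaries (D : SimplicialComplex V) (i : ℤ) : Submodule K (Finset V →₀ K) :=
  (D.chains K (i + 1)).map (boundary K)

/-- The reduced homology `Z_i / B_i` with coefficients in `K`. -/
abbrev ReducedHomology (D : SimplicialComplex V) (i : ℤ) : Type _ :=
  D.cycles K i ⧸ (D.boundaries K i).submoduleOf (D.cycles K i)

end Homology

/-- The path complex `Δ_{m,l}` of the line graph with `p` facets
`{x_{al}, …, x_{al + m - 1}}`, `0 ≤ a < p`, on the vertices `x_0, x_1, …`; here `x_v` is `v`. -/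
def line (m l p : ℕ) : SimplicialComplex ℕ :=
  generated {G | ∃ a < p, G = Set.Ico (a * l) (a * l + m)}

/-- `R` is a run of length `p`: it is a copy of the path complex of a line with `p` facets, under
a labelling `x` of its vertices without repetitions. -/
def IsRun (m l p : ℕ) (R : SimplicialComplex V) : Prop :=
  ∃ x : ℕ → V, Set.InjOn x (line m l p).vertexSet ∧
    ∀ G : Finset V, G ∈ R.faces ↔ ∃ F ∈ (line m l p).faces, (G : Set V) = x '' (F : Set ℕ)

/-- `D` is the disjoint union of runs of lengths `s j`. -/
def IsDisjointUnionOfRuns (m l : ℕ) {ι : Type*} (s : ι → ℕ) (D : SimplicialComplex V) : Prop :=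
  ∃ R : ι → SimplicialComplex V, (∀ j, IsRun m l (s j) (R j)) ∧
    (Pairwise fun j k => Disjoint (R j).vertexSet (R k).vertexSet) ∧
    D.faces = ⋃ j, (R j).faces

end SimplicialComplex

end PathComplexes

/-!
A face of `ℰ` is a set of vertices that misses some facet of `Γ`. If every facet through `v` also
contains `w`, then the link of `w` in `ℰ` is a cone with apex `v`, and deleting `w` does not change
the homology. If some facet has no vertex left but `v`, then the deletion of `v` in `ℰ` is a full
simplex, and the homology of `ℰ` is that of the link of `v`, one degree higher; passing to the link
removes all the facets through `v`.

On a run the first vertex of the first facet `F_b` forces `F_b` out, after which the first vertex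
beyond `F_b` forces out `F_{b+1}, …, F_{b+t}`, and a shorter run remains, with the first `s`
vertices of its first facet missing. So `t + 1` facets go for every two degrees. The steps for
different runs do not interact, so the degrees add up.
-/

namespace PathComplexes.SimplicialComplex

section Chains

variable {K : Type*} [Field K] {V : Type*} {D : SimplicialComplex V} {i : ℤ}

theorem map_supported_le {R M α : Type*} [Semiring R] [AddCommMonoid M] [Module R M] {S : Set α}
    {P : Submodule R M} (f : (α →₀ R) →ₗ[R] M) (h : ∀ a ∈ S, f (Finsupp.single a 1) ∈ P) :
    (Finsupp.supported R R S).map f ≤ P := by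
  rw [Finsupp.supported_eq_span_single, Submodule.map_span_le]
  rintro _ ⟨a, ha, rfl⟩
  exact h a ha

variable (K) in
/-- The chains of all degrees together; a subcomplex of `D` has a subspace of the chains of `D`. -/
def totalChains (D : SimplicialComplex V) : Submodule K (Finset V →₀ K) :=
  Finsupp.supported K K D.faces

theorem totalChains_mono {E : SimplicialComplex V} (h : D.faces ⊆ E.faces) :
    D.totalChains K ≤ E.totalChains K :=
  Finsupp.supported_mono h

theorem chains_mono {E : SimplicialComplex V} (h : D.faces ⊆ E.faces) (i : ℤ) :
    D.chains K i ≤ E.chains K i :=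
  Finsupp.supported_mono fun _ hσ => ⟨h hσ.1, hσ.2⟩

theorem chains_le_totalChains (D : SimplicialComplex V) (i : ℤ) :
    D.chains K i ≤ D.totalChains K :=
  Finsupp.supported_mono fun _ hσ => hσ.1

theorem filter_card_eq_self {c : Finset V →₀ K} (hc : c ∈ D.chains K i) :
    c.filter (fun σ => (σ.card : ℤ) = i + 1) = c := by
  rw [Finsupp.filter_eq_self_iff]
  exact fun σ hσ => (not_imp_comm.1 ((Finsupp.mem_supported' K c).1 hc σ) hσ).2

theorem filter_card_eq_zero {c : Finset V →₀ K} {j : ℤ} (hc : c ∈ D.chains K i) (hij : i ≠ j) :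
    c.filter (fun σ => (σ.card : ℤ) = j + 1) = 0 := by
  rw [Finsupp.filter_eq_zero_iff]
  exact fun σ hσ => (Finsupp.mem_supported' K c).1 hc σ fun h =>
    hij (add_right_cancel (h.2.symm.trans hσ))

theorem filter_card_mem_chains {c : Finset V →₀ K} (hc : c ∈ D.totalChains K) (i : ℤ) :
    c.filter (fun σ => (σ.card : ℤ) = i + 1) ∈ D.chains K i := by
  intro σ hσ
  rw [SetLike.mem_coe, Finsupp.support_filter, Finset.mem_filter] at hσ
  exact ⟨hc hσ.1, hσ.2⟩

end Chains

section Join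

variable {K : Type*} [Field K] {V : Type*} [LinearOrder V] {v w : V} {σ : Finset V}

theorem boundary_single (σ : Finset V) (k : K) :
    boundary K (Finsupp.single σ k) =
      ∑ v ∈ σ, Finsupp.single (σ.erase v) (k * (-1 : K) ^ (σ.filter (fun w => w < v)).card) := by
  simp [boundary, Finset.smul_sum]

variable (K) in
/-- Exterior multiplication by the vertex `v`: the sign is that of moving `v` to its place in the
order of the vertices, so that `∂ (v ∧ c) = c - v ∧ ∂ c`. -/
noncomputable def join (v : V) : (Finset V →₀ K) →ₗ[K] (Finset V →₀ K) :=
  Finsupp.linearCombination K fun σ => if v ∈ σ then 0 else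
    Finsupp.single (insert v σ) ((-1 : K) ^ (σ.filter (fun w => w < v)).card)

theorem join_single_of_mem (hv : v ∈ σ) (k : K) : join K v (Finsupp.single σ k) = 0 := by
  simp [join, hv]

theorem join_single_of_notMem (hv : v ∉ σ) (k : K) :
    join K v (Finsupp.single σ k) =
      Finsupp.single (insert v σ) (k * (-1 : K) ^ (σ.filter (fun w => w < v)).card) := by
  simp [join, hv]

theorem neg_one_pow_mul_self {R : Type*} [Ring R] (n : ℕ) : (-1 : R) ^ n * (-1 : R) ^ n = 1 := by
  rw [← pow_add, (Even.add_self n).neg_one_pow]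

theorem single_insert_eq_smul_join (hv : v ∉ σ) :
    (Finsupp.single (insert v σ) 1 : Finset V →₀ K) =
      (-1 : K) ^ (σ.filter (fun w => w < v)).card • join K v (Finsupp.single σ 1) := by
  rw [join_single_of_notMem hv, Finsupp.smul_single, one_mul, smul_eq_mul, neg_one_pow_mul_self]

theorem insert_erase_signs_cancel {R : Type*} [CommRing R] (hv : v ∉ σ) (hw : w ∈ σ) :
    (-1 : R) ^ (σ.filter (fun u => u < v)).card *
        (-1 : R) ^ ((insert v σ).filter (fun u => u < w)).card +
      (-1 : R) ^ (σ.filter (fun u => u < w)).card *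
        (-1 : R) ^ ((σ.erase w).filter (fun u => u < v)).card = 0 := by
  rcases lt_or_gt_of_ne (ne_of_mem_of_not_mem hw hv).symm with h | h
  · rw [Finset.filter_insert, if_pos h, Finset.card_insert_of_notMem (by simp [hv]),
      Finset.filter_erase, Finset.erase_eq_of_notMem (by simp [h.le])]
    ring
  · have hmem : w ∈ σ.filter (fun u => u < v) := Finset.mem_filter.2 ⟨hw, h⟩
    rw [Finset.filter_insert, if_neg h.le.not_gt, Finset.filter_erase,
      ← Finset.card_erase_add_one hmem]
    ring

theorem boundary_join_add_join_boundary_single (v : V) (σ : Finset V) :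
    boundary K (join K v (Finsupp.single σ 1)) + join K v (boundary K (Finsupp.single σ 1)) =
      Finsupp.single σ 1 := by
  by_cases hv : v ∈ σ
  · rw [join_single_of_mem hv, map_zero, zero_add, boundary_single, map_sum,
      Finset.sum_eq_single_of_mem v hv fun w _ hwv => join_single_of_mem (by simp [hv, hwv.symm]) _,
      join_single_of_notMem (by simp), Finset.insert_erase hv, Finset.filter_erase,
      Finset.erase_eq_of_notMem (by simp), one_mul, neg_one_pow_mul_self]
  · rw [join_single_of_notMem hv, boundary_single, boundary_single, Finset.sum_insert hv,
      Finset.erase_insert hv, map_sum, add_assoc, ← Finset.sum_add_distrib,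
      Finset.sum_eq_zero, add_zero, one_mul, Finset.filter_insert, if_neg (lt_irrefl v),
      neg_one_pow_mul_self]
    intro w hw
    rw [join_single_of_notMem (by simp [hv]),
      Finset.erase_insert_of_ne (ne_of_mem_of_not_mem hw hv).symm, ← Finsupp.single_add, one_mul,
      one_mul, insert_erase_signs_cancel hv hw, Finsupp.single_zero]

theorem boundary_join (v : V) (c : Finset V →₀ K) :
    boundary K (join K v c) = c - join K v (boundary K c) := by
  rw [eq_sub_iff_add_eq]
  have h : boundary K ∘ₗ join K v + join K v ∘ₗ boundary K = LinearMap.id :=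
    Finsupp.lhom_ext' fun σ => LinearMap.ext_ring (boundary_join_add_join_boundary_single v σ)
  exact LinearMap.congr_fun h c

theorem boundary_boundary (c : Finset V →₀ K) : boundary K (boundary K c) = 0 := by
  have h : boundary K ∘ₗ boundary K = (0 : (Finset V →₀ K) →ₗ[K] (Finset V →₀ K)) := by
    refine Finsupp.lhom_ext' fun σ => LinearMap.ext_ring ?_
    change boundary K (boundary K (Finsupp.single σ 1)) = 0
    induction σ using Finset.induction_on with
    | empty => rw [boundary_single, Finset.sum_empty, map_zero]
    | insert v τ hv ih =>
      rw [single_insert_eq_smul_join hv, map_smul, map_smul, boundary_join, map_sub, boundary_join,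
        ih, map_zero, sub_zero, sub_self, smul_zero]
  exact LinearMap.congr_fun h c

theorem boundary_mem_supported {S T : Set (Finset V)} (h : ∀ σ ∈ S, ∀ v ∈ σ, σ.erase v ∈ T)
    {c : Finset V →₀ K} (hc : c ∈ Finsupp.supported K K S) :
    boundary K c ∈ Finsupp.supported K K T := by
  refine map_supported_le (boundary K) (fun σ hσ => ?_) ⟨c, hc, rfl⟩
  rw [boundary_single]
  exact Submodule.sum_mem _ fun v hv => Finsupp.single_mem_supported K _ (h σ hσ v hv)

theorem join_mem_supported {S T : Set (Finset V)} (h : ∀ σ ∈ S, v ∉ σ → insert v σ ∈ T)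
    {c : Finset V →₀ K} (hc : c ∈ Finsupp.supported K K S) :
    join K v c ∈ Finsupp.supported K K T := by
  refine map_supported_le (join K v) (fun σ hσ => ?_) ⟨c, hc, rfl⟩
  by_cases hv : v ∈ σ
  · rw [join_single_of_mem hv]
    exact zero_mem _
  · rw [join_single_of_notMem hv]
    exact Finsupp.single_mem_supported K _ (h σ hσ hv)

theorem eq_zero_of_add_join_eq_zero {a b : Finset V →₀ K}
    (ha : a ∈ Finsupp.supported K K {σ | v ∉ σ}) (h : a + join K v b = 0) :
    a = 0 ∧ join K v b = 0 := by
  have hdisj : Disjoint {σ : Finset V | v ∉ σ} {σ | v ∈ σ} :=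
    Set.disjoint_left.2 fun _ hσ hσ' => hσ hσ'
  have hjoin : join K v b ∈ Finsupp.supported K K {σ | v ∈ σ} :=
    join_mem_supported (S := Set.univ) (fun σ _ _ => Finset.mem_insert_self v σ) (by simp)
  have ha0 : a = 0 := Submodule.disjoint_def.1 (Finsupp.disjoint_supported_supported hdisj) a ha
    (by rw [eq_neg_of_add_eq_zero_left h]; exact Submodule.neg_mem _ hjoin)
  exact ⟨ha0, by rwa [ha0, zero_add] at h⟩

theorem eq_zero_of_join_eq_zero {b : Finset V →₀ K}
    (hb : b ∈ Finsupp.supported K K {σ | v ∉ σ}) (h : join K v b = 0) : b = 0 := by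
  refine (eq_zero_of_add_join_eq_zero (b := -boundary K b) hb ?_).1
  rw [map_neg, ← sub_eq_add_neg, ← boundary_join, h, map_zero]

theorem filter_card_boundary (n : ℤ) (c : Finset V →₀ K) :
    (boundary K c).filter (fun σ => (σ.card : ℤ) = n) =
      boundary K (c.filter fun σ => (σ.card : ℤ) = n + 1) := by
  induction c using Finsupp.induction_linear with
  | zero => simp only [map_zero, Finsupp.filter_zero]
  | add c d hc hd => simp only [map_add, Finsupp.filter_add, hc, hd]
  | single σ k =>
    have hb : boundary K (Finsupp.single σ k) ∈
        Finsupp.supported K K {τ | (τ.card : ℤ) + 1 = σ.card} := by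
      refine boundary_mem_supported (S := {σ}) ?_ (Finsupp.single_mem_supported K k rfl)
      rintro _ rfl v hv
      exact_mod_cast Finset.card_erase_add_one hv
    rw [Finsupp.mem_supported'] at hb
    by_cases h : (σ.card : ℤ) = n + 1
    · rw [Finsupp.filter_single_of_pos (fun τ : Finset V => (τ.card : ℤ) = n + 1) h,
        Finsupp.filter_eq_self_iff]
      exact fun τ hτ => add_right_cancel ((not_imp_comm.1 (hb τ) hτ).trans h)
    · rw [Finsupp.filter_single_of_neg (fun τ : Finset V => (τ.card : ℤ) = n + 1) h, map_zero,
        Finsupp.filter_eq_zero_iff]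
      rintro τ rfl
      exact hb τ (Ne.symm h)

end Join

section Homology

variable {K : Type*} [Field K] {V : Type*} [LinearOrder V] {D : SimplicialComplex V} {i : ℤ}

variable (K) in
/-- The boundaries of all degrees together. -/
noncomputable def totalBoundaries (D : SimplicialComplex V) : Submodule K (Finset V →₀ K) :=
  (D.totalChains K).map (boundary K)

variable (K) in
/-- The vanishing of the reduced homology of `D` in all degrees; the complex without faces is
included. -/
def Acyclic (D : SimplicialComplex V) : Prop :=
  ∀ c ∈ D.totalChains K, boundary K c = 0 → c ∈ D.totalBoundaries K

variable (K) in
/-- The total reduced homology of `D` is one-dimensional, spanned by a class of degree `i`. -/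
def HomologyConcentrated (D : SimplicialComplex V) (i : ℤ) : Prop :=
  ∃ z ∈ D.cycles K i, z ∉ D.totalBoundaries K ∧
    ∀ c ∈ D.totalChains K, boundary K c = 0 → ∃ k : K, c - k • z ∈ D.totalBoundaries K

theorem boundaries_le_totalBoundaries (D : SimplicialComplex V) (i : ℤ) :
    D.boundaries K i ≤ D.totalBoundaries K :=
  Submodule.map_mono (chains_le_totalChains D (i + 1))

theorem boundary_mem_totalChains {c : Finset V →₀ K} (hc : c ∈ D.totalChains K) :
    boundary K c ∈ D.totalChains K :=
  boundary_mem_supported (fun _ hσ v _ => D.down_closed hσ (Finset.erase_subset v _)) hc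

theorem filter_card_mem_boundaries {b : Finset V →₀ K} (hb : b ∈ D.totalBoundaries K) (i : ℤ) :
    b.filter (fun σ => (σ.card : ℤ) = i + 1) ∈ D.boundaries K i := by
  obtain ⟨c, hc, rfl⟩ := hb
  exact ⟨_, filter_card_mem_chains hc (i + 1), (filter_card_boundary (i + 1) c).symm⟩

theorem mem_boundaries_of_mem_totalBoundaries {c : Finset V →₀ K} (hc : c ∈ D.chains K i)
    (hb : c ∈ D.totalBoundaries K) : c ∈ D.boundaries K i := by
  rw [← filter_card_eq_self hc]
  exact filter_card_mem_boundaries hb i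

theorem HomologyConcentrated.subsingleton (h : D.HomologyConcentrated K i) {j : ℤ} (hij : i ≠ j) :
    Subsingleton (D.ReducedHomology K j) := by
  obtain ⟨z, ⟨hz, -⟩, -, hspan⟩ := h
  rw [Submodule.Quotient.subsingleton_iff, Submodule.submoduleOf_eq_top]
  rintro c ⟨hc, hc0⟩
  obtain ⟨k, hk⟩ := hspan c (chains_le_totalChains D j hc) hc0
  have := filter_card_mem_boundaries hk j
  rwa [Finsupp.filter_sub, Finsupp.filter_smul, filter_card_eq_self hc,
    filter_card_eq_zero hz hij, smul_zero, sub_zero] at this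

theorem HomologyConcentrated.nonempty_equiv (h : D.HomologyConcentrated K i) :
    Nonempty (D.ReducedHomology K i ≃ₗ[K] K) := by
  obtain ⟨z, hz, hzb, hspan⟩ := h
  let ζ : D.ReducedHomology K i := Submodule.Quotient.mk ⟨z, hz⟩
  have hζ : ζ ≠ 0 := by
    rw [ne_eq, Submodule.Quotient.mk_eq_zero]
    exact fun h => hzb (boundaries_le_totalBoundaries D i h)
  refine ⟨(LinearEquiv.ofBijective (LinearMap.toSpanSingleton K _ ζ)
    ⟨LinearMap.ker_eq_bot.1 (LinearMap.ker_toSpanSingleton K hζ), fun y => ?_⟩).symm⟩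
  obtain ⟨⟨c, hc⟩, rfl⟩ := Submodule.Quotient.mk_surjective _ y
  obtain ⟨k, hk⟩ := hspan c (chains_le_totalChains D i hc.1) hc.2
  refine ⟨k, ((Submodule.Quotient.eq _).2 ?_).symm⟩
  exact mem_boundaries_of_mem_totalBoundaries
    (Submodule.sub_mem _ hc.1 (Submodule.smul_mem _ k hz.1)) hk

end Homology

section DeletionLink

variable {V : Type*}

/-- The deletion of the vertex `v`: the faces without `v`. -/
def deletion (D : SimplicialComplex V) (v : V) : SimplicialComplex V where
  faces := {σ | σ ∈ D.faces ∧ v ∉ σ}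
  down_closed := fun _ _ h hG => ⟨D.down_closed h.1 hG, fun hv => h.2 (hG hv)⟩

/-- The link of the vertex `v`; it has no faces if `v` is not a vertex. -/
def link [DecidableEq V] (D : SimplicialComplex V) (v : V) : SimplicialComplex V where
  faces := {σ | insert v σ ∈ D.faces ∧ v ∉ σ}
  down_closed := fun _ _ h hG =>
    ⟨D.down_closed h.1 (Finset.insert_subset_insert v hG), fun hv => h.2 (hG hv)⟩

/-- `D` is a cone with apex `v`, or has no faces. -/
def IsCone [DecidableEq V] (D : SimplicialComplex V) (v : V) : Prop :=
  ∀ σ ∈ D.faces, insert v σ ∈ D.faces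

theorem deletion_faces_subset (D : SimplicialComplex V) (v : V) :
    (D.deletion v).faces ⊆ D.faces :=
  fun _ h => h.1

theorem link_faces_subset_deletion [DecidableEq V] (D : SimplicialComplex V) (v : V) :
    (D.link v).faces ⊆ (D.deletion v).faces :=
  fun _ h => ⟨D.down_closed h.1 (Finset.subset_insert _ _), h.2⟩

end DeletionLink

section LongExactSequence

variable {K : Type*} [Field K] {V : Type*} [LinearOrder V] {D : SimplicialComplex V} {v : V} {i : ℤ}

theorem IsCone.acyclic (h : D.IsCone v) : D.Acyclic K := fun c hc h0 =>
  ⟨join K v c, join_mem_supported (fun σ hσ _ => h σ hσ) hc, by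
    rw [boundary_join, h0, map_zero, sub_zero]⟩

theorem join_mem_totalChains {c : Finset V →₀ K} (hc : c ∈ (D.link v).totalChains K) :
    join K v c ∈ D.totalChains K :=
  join_mem_supported (fun _ hσ _ => hσ.1) hc

theorem join_mem_chains {c : Finset V →₀ K} (hc : c ∈ (D.link v).chains K i) :
    join K v c ∈ D.chains K (i + 1) := by
  refine join_mem_supported ?_ hc
  intro σ hσ hv
  refine ⟨hσ.1.1, ?_⟩
  rw [Finset.card_insert_of_notMem hv, Nat.cast_add, hσ.2, Nat.cast_one]

theorem exists_eq_add_join (v : V) {c : Finset V →₀ K} (hc : c ∈ D.totalChains K) :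
    ∃ c₀ ∈ (D.deletion v).totalChains K, ∃ c₁ ∈ (D.link v).totalChains K, c₀ + join K v c₁ = c := by
  have hle : D.totalChains K ≤
      (D.deletion v).totalChains K ⊔ ((D.link v).totalChains K).map (join K v) := by
    rw [totalChains, Finsupp.supported_eq_span_single, Submodule.span_le]
    rintro _ ⟨σ, hσ, rfl⟩
    beta_reduce
    by_cases hv : v ∈ σ
    · refine Submodule.mem_sup_right ?_
      rw [← Finset.insert_erase hv, single_insert_eq_smul_join (Finset.notMem_erase v σ)]
      refine Submodule.smul_mem _ _ (Submodule.mem_map_of_mem (Finsupp.single_mem_supported K _ ?_))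
      exact ⟨by rwa [Finset.insert_erase hv], Finset.notMem_erase v σ⟩
    · exact Submodule.mem_sup_left (Finsupp.single_mem_supported K _ ⟨hσ, hv⟩)
  obtain ⟨c₀, hc₀, _, ⟨c₁, hc₁, rfl⟩, h⟩ := Submodule.mem_sup.1 (hle hc)
  exact ⟨c₀, hc₀, c₁, hc₁, h⟩

theorem boundary_add_join_eq {c₀ c₁ a b : Finset V →₀ K}
    (hc₀ : c₀ ∈ (D.deletion v).totalChains K) (hc₁ : c₁ ∈ (D.deletion v).totalChains K)
    (ha : a ∈ (D.deletion v).totalChains K) (hb : b ∈ (D.deletion v).totalChains K)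
    (h : boundary K (c₀ + join K v c₁) = a + join K v b) :
    boundary K c₀ + c₁ = a ∧ boundary K c₁ = -b := by
  have hsub : (D.deletion v).totalChains K ≤ Finsupp.supported K K {σ | v ∉ σ} :=
    Finsupp.supported_mono fun _ hσ => hσ.2
  have hsum : boundary K c₀ + c₁ - a + join K v (-boundary K c₁ - b) = 0 := by
    rw [map_add, boundary_join] at h
    rw [map_sub, map_neg, ← sub_eq_zero.2 h]
    abel
  obtain ⟨h₀, h₁⟩ := eq_zero_of_add_join_eq_zero
    (hsub (sub_mem (add_mem (boundary_mem_totalChains hc₀) hc₁) ha)) hsum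
  have h₂ := eq_zero_of_join_eq_zero
    (hsub (sub_mem (neg_mem (boundary_mem_totalChains hc₁)) hb)) h₁
  exact ⟨sub_eq_zero.1 h₀, neg_eq_iff_eq_neg.1 (sub_eq_zero.1 h₂)⟩

theorem exists_sub_boundary_mem_deletion (hL : (D.link v).Acyclic K) {c : Finset V →₀ K}
    (hc : c ∈ D.totalChains K) (hbc : boundary K c ∈ (D.deletion v).totalChains K) :
    ∃ e ∈ D.totalChains K, c - boundary K e ∈ (D.deletion v).totalChains K := by
  obtain ⟨c₀, hc₀, c₁, hc₁, rfl⟩ := exists_eq_add_join v hc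
  have hlink := totalChains_mono (K := K) (link_faces_subset_deletion D v)
  have h₁ := (boundary_add_join_eq hc₀ (hlink hc₁) hbc (zero_mem _)
    (by rw [map_zero, add_zero])).2
  obtain ⟨e, he, rfl⟩ := hL c₁ hc₁ (by rw [h₁, neg_zero])
  refine ⟨-join K v e, neg_mem (join_mem_totalChains he), ?_⟩
  have hsum : c₀ + join K v (boundary K e) - boundary K (-join K v e) = c₀ + e := by
    rw [map_neg, boundary_join]
    abel
  rw [hsum]
  exact add_mem hc₀ (hlink he)

theorem HomologyConcentrated.of_deletion (hL : (D.link v).Acyclic K)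
    (h : (D.deletion v).HomologyConcentrated K i) : D.HomologyConcentrated K i := by
  obtain ⟨z, ⟨hz, hz0⟩, hzb, hspan⟩ := h
  refine ⟨z, ⟨chains_mono (deletion_faces_subset D v) i hz, hz0⟩, ?_, ?_⟩
  · rintro ⟨b, hb, rfl⟩
    obtain ⟨e, -, hbe⟩ := exists_sub_boundary_mem_deletion hL hb (chains_le_totalChains _ i hz)
    exact hzb ⟨_, hbe, by rw [map_sub, boundary_boundary, sub_zero]⟩
  · intro c hc hc0
    obtain ⟨e, he, hce⟩ := exists_sub_boundary_mem_deletion hL hc (by rw [hc0]; exact zero_mem _)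
    obtain ⟨k, b, hb, hkb⟩ := hspan _ hce (by rw [map_sub, hc0, boundary_boundary, sub_zero])
    refine ⟨k, b + e, add_mem (totalChains_mono (deletion_faces_subset D v) hb) he, ?_⟩
    rw [map_add, hkb]
    abel

theorem HomologyConcentrated.of_link (hD : (D.deletion v).Acyclic K)
    (h : (D.link v).HomologyConcentrated K i) : D.HomologyConcentrated K (i + 1) := by
  obtain ⟨z, ⟨hz, hz0⟩, hzb, hspan⟩ := h
  rw [SetLike.mem_coe, LinearMap.mem_ker] at hz0
  have hlink := totalChains_mono (K := K) (link_faces_subset_deletion D v)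
  have hzD : z ∈ (D.deletion v).totalChains K := hlink (chains_le_totalChains _ i hz)
  -- The suspension of `z`, with `v` on one side and a filling `y` of `z` on the other.
  obtain ⟨y, hy, rfl⟩ : z ∈ (D.deletion v).boundaries K i :=
    mem_boundaries_of_mem_totalBoundaries
      (chains_mono (link_faces_subset_deletion D v) i hz) (hD z hzD hz0)
  have hy' := chains_le_totalChains _ _ hy
  refine ⟨join K v (boundary K y) - y, ⟨sub_mem (join_mem_chains hz)
    (chains_mono (deletion_faces_subset D v) _ hy), ?_⟩, ?_, fun c hc hc0 => ?_⟩
  · rw [SetLike.mem_coe, LinearMap.mem_ker, map_sub, boundary_join, boundary_boundary, map_zero,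
      sub_zero, sub_self]
  · rintro ⟨b, hb, hbz⟩
    obtain ⟨b₀, hb₀, b₁, hb₁, rfl⟩ := exists_eq_add_join v hb
    have h₁ := (boundary_add_join_eq hb₀ (hlink hb₁) (neg_mem hy') hzD (by rw [hbz]; abel)).2
    exact hzb ⟨-b₁, neg_mem hb₁, by rw [map_neg, h₁, neg_neg]⟩
  · obtain ⟨c₀, hc₀, c₁, hc₁, rfl⟩ := exists_eq_add_join v hc
    obtain ⟨h₀, h₁⟩ := boundary_add_join_eq hc₀ (hlink hc₁) (zero_mem _) (zero_mem _)
      (by rw [hc0, map_zero, add_zero])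
    obtain ⟨k, b, hb, hkb⟩ := hspan c₁ hc₁ (by rw [h₁, neg_zero])
    obtain ⟨e, he, heb⟩ := hD (c₀ + k • y + b)
      (add_mem (add_mem hc₀ (Submodule.smul_mem _ k hy')) (hlink hb))
      (by rw [map_add, map_add, map_smul, hkb, eq_neg_of_add_eq_zero_left h₀]; abel)
    refine ⟨k, e - join K v b, sub_mem (totalChains_mono (deletion_faces_subset D v) he)
      (join_mem_totalChains hb), ?_⟩
    rw [map_sub, boundary_join, heb, hkb, map_sub, map_smul, smul_sub]
    abel

theorem homologyConcentrated_of_faces_eq_singleton_empty (h : D.faces = {∅}) :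
    D.HomologyConcentrated K (-1) := by
  have htot : D.totalChains K = Submodule.span K {Finsupp.single ∅ 1} := by
    rw [totalChains, h, Finsupp.supported_eq_span_single, Set.image_singleton]
  have hbd : D.totalBoundaries K = ⊥ := by
    rw [totalBoundaries, htot, Submodule.map_span, Set.image_singleton, boundary_single,
      Finset.sum_empty, Submodule.span_zero_singleton]
  refine ⟨Finsupp.single ∅ 1, ⟨Finsupp.single_mem_supported K _ (by simp [h]), ?_⟩, ?_, ?_⟩
  · rw [SetLike.mem_coe, LinearMap.mem_ker, boundary_single, Finset.sum_empty]
  · simp [hbd]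
  · intro c hc _
    obtain ⟨k, rfl⟩ := Submodule.mem_span_singleton.1 (htot ▸ hc)
    exact ⟨k, by rw [sub_self]; exact zero_mem _⟩

end LongExactSequence

section Avoiding

variable {V : Type*}

/-- The subsets of `W` that are disjoint from some member of `A`. The complement of a complex on
the vertex set `W` with facets `A` has this form. -/
def avoiding (A : Set (Finset V)) (W : Finset V) : SimplicialComplex V where
  faces := {G | G ⊆ W ∧ ∃ F ∈ A, Disjoint G F}
  down_closed := fun _ _ h hG => ⟨hG.trans h.1, h.2.imp fun _ hF => ⟨hF.1, hF.2.mono_left hG⟩⟩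

theorem complement_eq_avoiding {D : SimplicialComplex V} {W : Finset V} (hW : D.vertexSet = W) :
    D.complement D.vertexSet = avoiding D.facets W := by
  ext G
  constructor
  · rintro ⟨_, ⟨F, hF, rfl⟩, hG⟩
    rw [hW, Set.subset_sdiff, Finset.coe_subset, Finset.disjoint_coe] at hG
    exact ⟨hG.1, F, hF, hG.2⟩
  · rintro ⟨hGW, F, hF, hGF⟩
    refine ⟨_, ⟨F, hF, rfl⟩, ?_⟩
    rw [hW, Set.subset_sdiff, Finset.coe_subset, Finset.disjoint_coe]
    exact ⟨hGW, hGF⟩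

theorem deletion_avoiding [DecidableEq V] (A : Set (Finset V)) (W : Finset V) (v : V) :
    (avoiding A W).deletion v = avoiding A (W.erase v) := by
  ext G
  simp only [deletion, avoiding, Set.mem_ofPred_eq, Finset.subset_erase]
  tauto

theorem link_avoiding [DecidableEq V] (A : Set (Finset V)) {W : Finset V} {v : V} (hv : v ∈ W) :
    (avoiding A W).link v = avoiding {F ∈ A | v ∉ F} (W.erase v) := by
  ext G
  simp only [link, avoiding, Set.mem_ofPred_eq, Finset.subset_erase, Finset.insert_subset_iff,
    Finset.disjoint_insert_left]
  tauto

theorem isCone_avoiding_of_notMem [DecidableEq V] {A : Set (Finset V)} {W : Finset V} {v : V}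
    (hv : v ∈ W) (h : ∀ F ∈ A, v ∉ F) : (avoiding A W).IsCone v := by
  rintro G ⟨hG, F, hF, hGF⟩
  exact ⟨Finset.insert_subset hv hG, F, hF, Finset.disjoint_insert_left.2 ⟨h F hF, hGF⟩⟩

theorem isCone_avoiding_of_disjoint [DecidableEq V] {A : Set (Finset V)} {W F : Finset V} {v : V}
    (hv : v ∈ W) (hF : F ∈ A) (h : Disjoint W F) : (avoiding A W).IsCone v := by
  rintro G ⟨hG, -⟩
  have hvG := Finset.insert_subset hv hG
  exact ⟨hvG, F, hF, h.mono_left hvG⟩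

theorem avoiding_faces_eq_singleton_empty [DecidableEq V] {A : Set (Finset V)} {W : Finset V}
    {v : V} (hA : A.Nonempty) (hW : W.erase v = ∅) (hv : {F ∈ A | v ∉ F} = ∅) :
    (avoiding A W).faces = {∅} := by
  ext G
  rw [Set.mem_singleton_iff]
  constructor
  · rintro ⟨hGW, F, hF, hGF⟩
    have hvF : v ∈ F := by
      by_contra hvF
      exact hv.le (show F ∈ {F ∈ A | v ∉ F} from ⟨hF, hvF⟩)
    have hvG : v ∉ G := fun h => Finset.disjoint_left.1 hGF h hvF
    exact Finset.subset_empty.1 (hW ▸ Finset.subset_erase.2 ⟨hGW, hvG⟩)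
  · rintro rfl
    exact ⟨Finset.empty_subset W, hA.imp fun F hF => ⟨hF, Finset.disjoint_empty_left F⟩⟩

end Avoiding

/-- The family `A` of sets on the points `X` reduces to nothing by deletions of a point `w` that
lies in all the members of `A` through another point `v`, and by `n` removals of a point together
with all the members of `A` through it, where one member has no other point in `X`. Members of `A`
are not truncated when points are deleted. -/
inductive Collapses {α : Type*} [DecidableEq α] : Finset α → Set (Finset α) → ℕ → Prop
  | nil : Collapses ∅ ∅ 0
  | dominate {X : Finset α} {A : Set (Finset α)} {n : ℕ} (v w : α) : v ∈ X.erase w → w ∈ X →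
      (∀ F ∈ A, v ∈ F → w ∈ F) → Collapses (X.erase w) A n → Collapses X A n
  | force {X : Finset α} {A : Set (Finset α)} {n : ℕ} (v : α) (F : Finset α) : F ∈ A →
      X ∩ F = {v} → Collapses (X.erase v) {G ∈ A | v ∉ G} n → Collapses X A (n + 1)

namespace Collapses

section SetSystems

variable {α : Type*} [DecidableEq α] {X Y : Finset α} {A B : Set (Finset α)} {k n : ℕ}

theorem eq_empty (h : Collapses X A 0) : X = ∅ ∧ A = ∅ := by
  generalize h0 : 0 = d at h
  induction h with
  | nil => exact ⟨rfl, rfl⟩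
  | dominate v w hv _ _ _ ih => exact absurd ((ih h0).1 ▸ hv) (Finset.notMem_empty v)
  | force => exact absurd h0.symm (Nat.succ_ne_zero _)

theorem empty_notMem (h : Collapses X A n) : ∅ ∉ A := by
  induction h with
  | nil => exact Set.notMem_empty ∅
  | dominate _ _ _ _ _ _ ih => exact ih
  | force v _ _ _ _ ih => exact fun hA => ih ⟨hA, Finset.notMem_empty v⟩

theorem nonempty (h : Collapses X A (n + 1)) : X.Nonempty := by
  cases h with
  | dominate v w _ hw => exact ⟨w, hw⟩
  | force v F _ hXF => exact ⟨v, (Finset.mem_inter.1 (hXF ▸ Finset.mem_singleton_self v)).1⟩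

theorem of_subset (hYX : Y ⊆ X) (h : ∀ w ∈ X, w ∉ Y → ∃ v ∈ Y, ∀ F ∈ A, v ∈ F → w ∈ F)
    (hY : Collapses Y A n) : Collapses X A n := by
  induction X using Finset.strongInduction with
  | H X ih =>
    rcases hYX.eq_or_ssubset with rfl | hss
    · exact hY
    · obtain ⟨w, hwX, hwY⟩ := Finset.exists_of_ssubset hss
      obtain ⟨v, hv, hvw⟩ := h w hwX hwY
      have hYX' : Y ⊆ X.erase w := Finset.subset_erase.2 ⟨hYX, hwY⟩
      exact dominate v w (hYX' hv) hwX hvw (ih _ (Finset.erase_ssubset hwX) hYX'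
        fun u hu => h u (Finset.mem_of_mem_erase hu))

theorem image {β : Type*} [DecidableEq β] {x : α → β} {S : Set α} (hx : Set.InjOn x S)
    (hX : ↑X ⊆ S) (hA : ∀ F ∈ A, ↑F ⊆ S) (h : Collapses X A n) :
    Collapses (X.image x) (Finset.image x '' A) n := by
  have image_erase {X : Finset α} {v : α} (hX : ↑X ⊆ S) (hv : v ∈ X) :
      (X.image x).erase (x v) = (X.erase v).image x := by
    rw [← Finset.sdiff_singleton_eq_erase, ← Finset.sdiff_singleton_eq_erase,
      Finset.image_sdiff_of_injOn (hx.mono hX) (by simpa using hv), Finset.image_singleton]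
  have mem_image_iff {F : Finset α} {v : α} (hF : ↑F ⊆ S) (hv : v ∈ S) :
      x v ∈ F.image x ↔ v ∈ F := by
    rw [← Finset.mem_coe, Finset.coe_image, hx.mem_image_iff hF hv, Finset.mem_coe]
  induction h with
  | nil => simpa using nil
  | @dominate X A n v w hv hw hvw _ ih =>
    refine dominate (x v) (x w) ?_ (Finset.mem_image_of_mem x hw) ?_ ?_
    · rw [image_erase hX hw]
      exact Finset.mem_image_of_mem x hv
    · rintro _ ⟨F, hF, rfl⟩
      rw [mem_image_iff (hA F hF) (hX (Finset.mem_of_mem_erase hv)),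
        mem_image_iff (hA F hF) (hX hw)]
      exact hvw F hF
    · rw [image_erase hX hw]
      exact ih ((Finset.coe_subset.2 (Finset.erase_subset w X)).trans hX) hA
  | @force X A n v F hF hXF _ ih =>
    have hv : v ∈ X := Finset.inter_subset_left (hXF ▸ Finset.mem_singleton_self v)
    refine force (x v) (F.image x) ⟨F, hF, rfl⟩ ?_ ?_
    · rw [← Finset.image_inter_of_injOn _ _ (hx.mono (Set.union_subset hX (hA F hF))), hXF,
        Finset.image_singleton]
    · have hA' : {G ∈ Finset.image x '' A | x v ∉ G} = Finset.image x '' {G ∈ A | v ∉ G} := by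
        ext G
        constructor
        · rintro ⟨⟨G, hG, rfl⟩, hvG⟩
          exact ⟨G, ⟨hG, fun h => hvG (Finset.mem_image_of_mem x h)⟩, rfl⟩
        · rintro ⟨G, ⟨hG, hvG⟩, rfl⟩
          exact ⟨⟨G, hG, rfl⟩, by rwa [mem_image_iff (hA G hG) (hX hv)]⟩
      rw [image_erase hX hv, hA']
      exact ih ((Finset.coe_subset.2 (Finset.erase_subset v X)).trans hX) fun G hG => hA G hG.1

theorem union (hXY : Disjoint X Y) (hXB : ∀ F ∈ B, Disjoint X F) (hYA : ∀ F ∈ A, Disjoint Y F)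
    (hX : Collapses X A k) (hY : Collapses Y B n) : Collapses (X ∪ Y) (A ∪ B) (k + n) := by
  have union_erase {X : Finset α} {v : α} (hXY : Disjoint X Y) (hv : v ∈ X) :
      (X ∪ Y).erase v = X.erase v ∪ Y := by
    rw [Finset.erase_union_distrib, Finset.erase_eq_of_notMem (Finset.disjoint_left.1 hXY hv)]
  induction hX with
  | nil => simpa using hY
  | @dominate X A k v w hv hw hvw _ ih =>
    have hsub := Finset.erase_subset w X
    refine dominate v w ?_ (Finset.mem_union_left Y hw) ?_ ?_
    · exact union_erase hXY hw ▸ Finset.mem_union_left Y hv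
    · rintro F (hF | hF) hvF
      · exact hvw F hF hvF
      · exact absurd hvF (Finset.disjoint_left.1 (hXB F hF) (hsub hv))
    · rw [union_erase hXY hw]
      exact ih (hXY.mono_left hsub) (fun F hF => (hXB F hF).mono_left hsub) hYA
  | @force X A k v F hF hXF _ ih =>
    have hv : v ∈ X := Finset.inter_subset_left (hXF ▸ Finset.mem_singleton_self v)
    have hsub := Finset.erase_subset v X
    rw [Nat.add_right_comm]
    refine force v F (Or.inl hF) ?_ ?_
    · rw [Finset.union_inter_distrib_right, hXF, Finset.disjoint_iff_inter_eq_empty.1 (hYA F hF),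
        Finset.union_empty]
    · have hB : {G ∈ A ∪ B | v ∉ G} = {G ∈ A | v ∉ G} ∪ B := by
        ext G
        have := fun hG => Finset.disjoint_left.1 (hXB G hG) hv
        simp only [Set.mem_union, Set.mem_ofPred_eq]
        tauto
      rw [union_erase hXY hv, hB]
      exact ih (hXY.mono_left hsub) (fun F hF => (hXB F hF).mono_left hsub)
        fun F hF => hYA F hF.1

theorem biUnion {ι : Type*} {W : ι → Finset α} {A : ι → Set (Finset α)} {n : ι → ℕ}
    (hW : Pairwise fun j k => Disjoint (W j) (W k)) (hA : ∀ j, ∀ F ∈ A j, F ⊆ W j)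
    (h : ∀ j, Collapses (W j) (A j) (n j)) (S : Finset ι) :
    Collapses (S.biUnion W) (⋃ j ∈ S, A j) (∑ j ∈ S, n j) := by
  classical
  induction S using Finset.induction_on with
  | empty => simpa using nil
  | insert j S hj ih =>
    have hne : ∀ k ∈ S, j ≠ k := fun k hk hjk => hj (hjk ▸ hk)
    rw [Finset.biUnion_insert, Finset.set_biUnion_insert, Finset.sum_insert hj]
    refine (h j).union ?_ ?_ ?_ ih
    · exact Finset.disjoint_biUnion_right _ _ _ |>.2 fun k hk => hW (hne k hk)
    · intro F hF
      obtain ⟨k, hk, hF⟩ := Set.mem_iUnion₂.1 hF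
      exact (hW (hne k hk)).mono_right (hA k F hF)
    · exact fun F hF => (Finset.disjoint_biUnion_left _ _ _).2 fun k hk =>
        (hW (hne k hk)).symm.mono_right (hA j F hF)

end SetSystems

section Homology

variable {K : Type*} [Field K] {V : Type*} [LinearOrder V] {X : Finset V} {A : Set (Finset V)}
  {n : ℕ}

theorem homologyConcentrated (h : Collapses X A n) (hn : n ≠ 0) :
    (avoiding A X).HomologyConcentrated K ((n : ℤ) - 2) := by
  induction h with
  | nil => exact absurd rfl hn
  | @dominate X A n v w hv hw hvw _ ih =>
    refine .of_deletion (v := w) ?_ ?_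
    · rw [link_avoiding A hw]
      exact (isCone_avoiding_of_notMem hv fun F hF hvF => hF.2 (hvw F hF.1 hvF)).acyclic
    · rw [deletion_avoiding]
      exact ih hn
  | @force X A n v F hF hXF hcol ih =>
    have hv : v ∈ X := Finset.inter_subset_left (hXF ▸ Finset.mem_singleton_self v)
    have hdisj : Disjoint (X.erase v) F := by
      rw [Finset.disjoint_iff_inter_eq_empty, Finset.erase_inter, hXF, Finset.erase_singleton]
    cases n with
    | zero =>
      obtain ⟨hX, hA⟩ := hcol.eq_empty
      exact homologyConcentrated_of_faces_eq_singleton_empty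
        (avoiding_faces_eq_singleton_empty ⟨F, hF⟩ hX hA)
    | succ n =>
      obtain ⟨u, hu⟩ := hcol.nonempty
      have hdeg : ((n + 1 + 1 : ℕ) : ℤ) - 2 = ((n + 1 : ℕ) : ℤ) - 2 + 1 := by push_cast; ring
      rw [hdeg]
      refine .of_link (v := v) ?_ ?_
      · rw [deletion_avoiding]
        exact (isCone_avoiding_of_disjoint hu hF hdisj).acyclic
      · rw [link_avoiding A hv]
        exact ih (Nat.succ_ne_zero n)

end Homology

end Collapses

section Line

/-- The facet `{x_{al}, …, x_{al + m - 1}}` of a line, which is `F_{a + 1}` of the run. -/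
def lineFacet (m l a : ℕ) : Finset ℕ := Finset.Ico (a * l) (a * l + m)

variable {m l s t a b c n u : ℕ}

theorem mem_lineFacet : u ∈ lineFacet m l a ↔ a * l ≤ u ∧ u < a * l + m :=
  Finset.mem_Ico

theorem mul_add_mem_lineFacet_iff (hu : u < l) (hlm : l ≤ m) (hba : b ≤ a) :
    b * l + u ∈ lineFacet m l a ↔ a = b := by
  rw [mem_lineFacet]
  refine ⟨fun h => ?_, by rintro rfl; omega⟩
  have hlt : a * l < (b + 1) * l := by linarith [h.1]
  exact le_antisymm (Nat.lt_succ_iff.1 (lt_of_mul_lt_mul_right' hlt)) hba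

theorem mul_add_length_mem_lineFacet_iff (hm : m = t * l + s) (hs : s < l) (hba : b < a) :
    b * l + m ∈ lineFacet m l a ↔ a ≤ b + t := by
  have hlt : b * l < a * l := Nat.mul_lt_mul_of_pos_right hba (by omega)
  rw [mem_lineFacet, and_iff_left (by omega)]
  refine ⟨fun hab => ?_, fun hab => ?_⟩
  · have hlt : a * l < (b + t + 1) * l := by linarith
    exact Nat.lt_succ_iff.1 (lt_of_mul_lt_mul_right' hlt)
  · have := Nat.mul_le_mul_right l hab
    linarith

namespace Collapses

theorem force_Ico {α ι : Type*} [LinearOrder α] [LocallyFiniteOrder α] {x y z : α} {S : Set ι}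
    {f : ι → Finset α} {i : ι} (hxz : x < z) (hi : i ∈ S) (hxi : x ∈ f i) (hiy : ∀ u ∈ f i, u < y)
    (hS : ∀ j ∈ S, x ∈ f j → Finset.Ico x y ⊆ f j)
    (h : Collapses (Finset.Ico y z) (f '' {j ∈ S | x ∉ f j}) n) :
    Collapses (Finset.Ico x z) (f '' S) (n + 1) := by
  have hxy : x < y := hiy x hxi
  have hx : x ∉ Finset.Ico y z := by simp [hxy]
  have hsub : insert x (Finset.Ico y z) ⊆ Finset.Ico x z :=
    Finset.insert_subset (by simpa) (Finset.Ico_subset_Ico_left hxy.le)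
  have hinter : insert x (Finset.Ico y z) ∩ f i = {x} := by
    rw [Finset.insert_inter_of_mem hxi, Finset.disjoint_iff_inter_eq_empty.1, insert_empty_eq]
    exact Finset.disjoint_left.2 fun u hu hui => (hiy u hui).not_ge (Finset.mem_Ico.1 hu).1
  refine of_subset hsub ?_ (force x (f i) ⟨i, hi, rfl⟩ hinter ?_)
  · intro w hw hw'
    simp only [Finset.mem_insert, Finset.mem_Ico, not_or, not_and'] at hw hw'
    refine ⟨x, Finset.mem_insert_self _ _, ?_⟩
    rintro _ ⟨j, hj, rfl⟩ hxj
    exact hS j hj hxj (Finset.mem_Ico.2 ⟨hw.1, not_le.1 (hw'.2 hw.2)⟩)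
  · have hrest : {F ∈ f '' S | x ∉ F} = f '' {j ∈ S | x ∉ f j} :=
      (Set.image_inter_preimage f S {F | x ∉ F}).symm
    rwa [Finset.erase_insert hx, hrest]

theorem line_first (hu : u < l) (hlm : l ≤ m) (hbc : b ≤ c)
    (h : Collapses (Finset.Ico (b * l + m) (c * l + m)) (lineFacet m l '' Set.Icc (b + 1) c) n) :
    Collapses (Finset.Ico (b * l + u) (c * l + m)) (lineFacet m l '' Set.Icc b c) (n + 1) := by
  have hle := Nat.mul_le_mul_right l hbc
  have hrest : {a ∈ Set.Icc b c | b * l + u ∉ lineFacet m l a} = Set.Icc (b + 1) c := by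
    ext a
    have := mul_add_mem_lineFacet_iff (a := a) (b := b) hu hlm
    grind
  refine force_Ico (y := b * l + m) (by omega) ⟨le_rfl, hbc⟩
    ((mul_add_mem_lineFacet_iff hu hlm le_rfl).2 rfl) (fun v hv => (mem_lineFacet.1 hv).2) ?_
    (hrest ▸ h)
  intro a ha hua
  rw [(mul_add_mem_lineFacet_iff hu hlm ha.1).1 hua]
  exact Finset.Ico_subset_Ico_left (Nat.le_add_right _ _)

theorem line_second (hm : m = t * l + s) (hs : s < l) (ht : 1 ≤ t) (hbc : b < c)
    (h : Collapses (Finset.Ico ((b + t + 1) * l + s) (c * l + m))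
      (lineFacet m l '' Set.Icc (b + t + 1) c) n) :
    Collapses (Finset.Ico (b * l + m) (c * l + m)) (lineFacet m l '' Set.Icc (b + 1) c)
      (n + 1) := by
  have hlt : b * l < c * l := Nat.mul_lt_mul_of_pos_right hbc (by omega)
  have hend : (b + t + 1) * l + s = (b + 1) * l + m := by rw [hm]; ring
  have hrest : {a ∈ Set.Icc (b + 1) c | b * l + m ∉ lineFacet m l a} = Set.Icc (b + t + 1) c := by
    ext a
    have := mul_add_length_mem_lineFacet_iff (a := a) (b := b) hm hs
    grind
  refine force_Ico (i := b + 1) (y := (b + t + 1) * l + s) (by omega) ⟨le_rfl, hbc⟩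
    ((mul_add_length_mem_lineFacet_iff hm hs (Nat.lt_succ_self b)).2 (by omega))
    (fun v hv => hend ▸ (mem_lineFacet.1 hv).2) ?_ (hrest ▸ h)
  intro a ha hva
  have hle := Nat.mul_le_mul_right l ha.1
  exact Finset.Ico_subset_Ico (mem_lineFacet.1 hva).1 (by omega)

theorem line_mul_add_one (hm : m = t * l + s) (hs : s < l) (ht : 1 ≤ t) (hu : u < l)
    (b p : ℕ) :
    Collapses (Finset.Ico (b * l + u) ((b + p * (t + 1)) * l + m))
      (lineFacet m l '' Set.Icc b (b + p * (t + 1))) (2 * p + 1) := by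
  have hlm : l ≤ m := by nlinarith
  induction p generalizing b u with
  | zero =>
    refine line_first hu hlm (by omega) ?_
    simpa using nil
  | succ p ih =>
    refine line_first hu hlm (by omega) (line_second hm hs ht (by grind) ?_)
    have hc : b + (p + 1) * (t + 1) = b + t + 1 + p * (t + 1) := by ring
    rw [hc]
    exact ih hs (b + t + 1)

theorem line_mul_add_two (hm : m = t * l + s) (hs : s < l) (ht : 1 ≤ t) (hu : u < l)
    (b q : ℕ) :
    Collapses (Finset.Ico (b * l + u) ((b + q * (t + 1) + 1) * l + m))
      (lineFacet m l '' Set.Icc b (b + q * (t + 1) + 1)) (2 * q + 2) := by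
  have hlm : l ≤ m := by nlinarith
  induction q generalizing b u with
  | zero =>
    have hend : (b + t + 1) * l + s = (b + 1) * l + m := by rw [hm]; ring
    refine line_first hu hlm (by omega) (line_second hm hs ht (by omega) ?_)
    rw [zero_mul, add_zero, hend, Finset.Ico_self, Set.Icc_eq_empty (by omega), Set.image_empty]
    exact nil
  | succ q ih =>
    refine line_first hu hlm (by omega) (line_second hm hs ht (by grind) ?_)
    have hc : b + (q + 1) * (t + 1) + 1 = b + t + 1 + q * (t + 1) + 1 := by ring
    rw [hc]
    exact ih hs (b + t + 1)

end Collapses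

end Line

section FacetsCollapse

variable {V : Type*} {D : SimplicialComplex V} {n : ℕ}

/-- The family of the facets of `D` on the (finite) set of vertices of `D` collapses with `n`
forced points. -/
def FacetsCollapse [DecidableEq V] (D : SimplicialComplex V) (n : ℕ) : Prop :=
  ∃ W : Finset V, D.vertexSet = W ∧ Collapses W D.facets n

theorem FacetsCollapse.homologyConcentrated_complement {K : Type*} [Field K] [LinearOrder V]
    (h : D.FacetsCollapse n) (hn : n ≠ 0) :
    (D.complement D.vertexSet).HomologyConcentrated K ((n : ℤ) - 2) := by
  obtain ⟨W, hW, hcol⟩ := h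
  rw [complement_eq_avoiding hW]
  exact hcol.homologyConcentrated hn

theorem coe_subset_vertexSet {F : Finset V} (hF : F ∈ D.faces) : ↑F ⊆ D.vertexSet :=
  fun _ hv => D.down_closed hF (Finset.singleton_subset_iff.2 hv)

theorem facets_generated {S : Set (Finset V)} (hS : IsAntichain (· ⊆ ·) S) :
    (generated ((fun F : Finset V => (F : Set V)) '' S)).facets = S := by
  have mem_faces {G : Finset V} :
      G ∈ (generated ((fun F : Finset V => (F : Set V)) '' S)).faces ↔ ∃ F ∈ S, G ⊆ F := by
    simp [generated]
  ext F
  constructor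
  · rintro ⟨hF, hmax⟩
    obtain ⟨G, hG, hFG⟩ := mem_faces.1 hF
    rwa [hFG.antisymm (hmax (mem_faces.2 ⟨G, hG, subset_rfl⟩) hFG)]
  · refine fun hF => ⟨mem_faces.2 ⟨F, hF, subset_rfl⟩, fun G hG hFG => ?_⟩
    obtain ⟨F', hF', hGF'⟩ := mem_faces.1 hG
    rwa [hS.eq hF hF' (hFG.trans hGF')]

section Relabelling

variable [DecidableEq V] {α : Type*} {E : SimplicialComplex α} {x : α → V}

theorem vertexSet_eq_image (h : D.faces = Finset.image x '' E.faces) :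
    D.vertexSet = x '' E.vertexSet := by
  ext v
  constructor
  · intro hv
    obtain ⟨F, hF, hFv⟩ := h.le hv
    obtain ⟨u, hu, rfl⟩ := Finset.mem_image.1 (hFv ▸ Finset.mem_singleton_self v)
    exact ⟨u, coe_subset_vertexSet hF hu, rfl⟩
  · rintro ⟨u, hu, rfl⟩
    exact h.ge ⟨{u}, hu, Finset.image_singleton x u⟩

theorem facets_eq_image (hx : Set.InjOn x E.vertexSet) (h : D.faces = Finset.image x '' E.faces) :
    D.facets = Finset.image x '' E.facets := by
  rw [facets, facets, h]
  refine (image_monotone_setOfPred_maximal_mem fun F G hF hG => ?_).symm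
  rw [← Finset.coe_subset, Finset.coe_image, Finset.coe_image,
    hx.image_subset_image_iff (coe_subset_vertexSet hF) (coe_subset_vertexSet hG),
    Finset.coe_subset]

theorem FacetsCollapse.relabel [DecidableEq α] (hx : Set.InjOn x E.vertexSet)
    (h : D.faces = Finset.image x '' E.faces) (hE : E.FacetsCollapse n) : D.FacetsCollapse n := by
  obtain ⟨W, hW, hcol⟩ := hE
  refine ⟨W.image x, ?_, ?_⟩
  · rw [vertexSet_eq_image h, hW, Finset.coe_image]
  · rw [facets_eq_image hx h]
    exact hcol.image hx hW.ge fun F hF => coe_subset_vertexSet hF.prop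

end Relabelling

section DisjointUnion

variable {ι : Type*} {R : ι → SimplicialComplex V}

theorem vertexSet_eq_iUnion (hD : D.faces = ⋃ j, (R j).faces) :
    D.vertexSet = ⋃ j, (R j).vertexSet := by
  ext v
  simp only [vertexSet, hD, Set.mem_ofPred_eq, Set.mem_iUnion]

theorem facets_eq_iUnion (hR : Pairwise fun j k => Disjoint (R j).vertexSet (R k).vertexSet)
    (hempty : ∀ j, ∅ ∉ (R j).facets) (hD : D.faces = ⋃ j, (R j).faces) :
    D.facets = ⋃ j, (R j).facets := by
  have hle (j : ι) : (R j).faces ⊆ D.faces :=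
    (Set.subset_iUnion (fun j => (R j).faces) j).trans hD.ge
  ext F
  rw [Set.mem_iUnion]
  constructor
  · rintro ⟨hF, hmax⟩
    obtain ⟨j, hFj⟩ := Set.mem_iUnion.1 (hD.le hF)
    exact ⟨j, hFj, fun G hG hFG => hmax (hle j hG) hFG⟩
  · rintro ⟨j, hF⟩
    obtain ⟨v, hv⟩ := Finset.nonempty_iff_ne_empty.2 (ne_of_mem_of_not_mem hF (hempty j))
    refine ⟨hle j hF.prop, fun G hG hFG => ?_⟩
    obtain ⟨k, hGk⟩ := Set.mem_iUnion.1 (hD.le hG)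
    obtain rfl : j = k := by
      by_contra hjk
      exact Set.disjoint_left.1 (hR hjk) (coe_subset_vertexSet hF.prop hv)
        (coe_subset_vertexSet hGk (hFG hv))
    exact hF.2 hGk hFG

theorem FacetsCollapse.iUnion [DecidableEq V] [Fintype ι] {n : ι → ℕ}
    (hR : Pairwise fun j k => Disjoint (R j).vertexSet (R k).vertexSet)
    (hD : D.faces = ⋃ j, (R j).faces) (h : ∀ j, (R j).FacetsCollapse (n j)) :
    D.FacetsCollapse (∑ j, n j) := by
  choose W hW hcol using h
  have hdisj : Pairwise fun j k => Disjoint (W j) (W k) := fun j k hjk => by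
    have hVjk : Disjoint (R j).vertexSet (R k).vertexSet := hR hjk
    change Disjoint (W j) (W k)
    rwa [hW, hW, Finset.disjoint_coe] at hVjk
  have hsub (j : ι) (F : Finset V) (hF : F ∈ (R j).facets) : F ⊆ W j :=
    Finset.coe_subset.1 (hW j ▸ coe_subset_vertexSet hF.prop)
  refine ⟨Finset.univ.biUnion W, ?_, ?_⟩
  · simp [vertexSet_eq_iUnion hD, hW]
  · rw [facets_eq_iUnion hR (fun j => (hcol j).empty_notMem) hD]
    simpa using Collapses.biUnion hdisj hsub hcol Finset.univ

end DisjointUnion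

end FacetsCollapse

section Runs

variable {V : Type*} {m l r s t n c : ℕ}

theorem line_eq_generated (m l r : ℕ) :
    line m l r = generated ((fun F : Finset ℕ => (F : Set ℕ)) '' (lineFacet m l '' Set.Iio r)) := by
  rw [line, Set.image_image]
  congr 1
  ext G
  simp [lineFacet, eq_comm]

theorem facets_line (hl : 0 < l) (hm : 0 < m) (r : ℕ) :
    (line m l r).facets = lineFacet m l '' Set.Iio r := by
  rw [line_eq_generated, facets_generated]
  rintro _ ⟨a, -, rfl⟩ _ ⟨b, -, rfl⟩ hab hsub
  obtain ⟨hba, hab'⟩ := (Finset.Ico_subset_Ico_iff (Nat.lt_add_of_pos_right hm)).1 hsub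
  have hmul : a * l = b * l := hba.antisymm' (Nat.le_of_add_le_add_right hab')
  exact hab (by rw [Nat.eq_of_mul_eq_mul_right hl hmul])

theorem vertexSet_line (hlm : l ≤ m) (c : ℕ) :
    (line m l (c + 1)).vertexSet = Set.Iio (c * l + m) := by
  ext v
  simp only [vertexSet, line, generated, Set.mem_ofPred_eq, Finset.coe_singleton,
    Set.singleton_subset_iff, Set.mem_Iio]
  constructor
  · rintro ⟨_, ⟨a, ha, rfl⟩, hv⟩
    have := Nat.mul_le_mul_right l (Nat.lt_succ_iff.1 ha)
    exact hv.2.trans_le (by omega)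
  · intro hv
    rcases le_or_gt (c * l) v with hcv | hvc
    · exact ⟨_, ⟨c, c.lt_succ_self, rfl⟩, hcv, hv⟩
    · have hlt : v / l < c := Nat.div_lt_of_lt_mul (by rwa [mul_comm])
      have hl : 0 < l := Nat.pos_of_ne_zero fun h => by simp [h] at hvc
      refine ⟨_, ⟨v / l, hlt.trans c.lt_succ_self, rfl⟩, Nat.div_mul_le_self v l, ?_⟩
      exact (Nat.lt_div_mul_add hl).trans_le (by omega)

theorem facetsCollapse_line (hl : 0 < l) (hlm : l ≤ m)
    (h : Collapses (Finset.Ico 0 (c * l + m)) (lineFacet m l '' Set.Icc 0 c) n) :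
    (line m l (c + 1)).FacetsCollapse n := by
  refine ⟨Finset.Ico 0 (c * l + m), ?_, ?_⟩
  · rw [vertexSet_line hlm, Nat.Ico_zero_eq_range, Finset.coe_range]
  · have hIio : Set.Iio (c + 1) = Set.Icc 0 c := by
      ext a
      simp
    rwa [facets_line hl (hl.trans_le hlm), hIio]

theorem facetsCollapse_line_mul_add_one (hm : m = t * l + s) (hs : s < l) (ht : 1 ≤ t) (p : ℕ) :
    (line m l (p * (t + 1) + 1)).FacetsCollapse (2 * p + 1) := by
  have hl : 0 < l := by omega
  refine facetsCollapse_line hl (by nlinarith) ?_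
  simpa only [zero_mul, zero_add] using Collapses.line_mul_add_one hm hs ht hl 0 p

theorem facetsCollapse_line_mul_add_two (hm : m = t * l + s) (hs : s < l) (ht : 1 ≤ t) (q : ℕ) :
    (line m l (q * (t + 1) + 2)).FacetsCollapse (2 * q + 2) := by
  have hl : 0 < l := by omega
  refine facetsCollapse_line hl (by nlinarith) ?_
  simpa only [zero_mul, zero_add] using Collapses.line_mul_add_two hm hs ht hl 0 q

theorem IsRun.facetsCollapse [DecidableEq V] {R : SimplicialComplex V} (hR : IsRun m l r R)
    (h : (line m l r).FacetsCollapse n) : R.FacetsCollapse n := by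
  obtain ⟨x, hx, hfaces⟩ := hR
  refine h.relabel hx ?_
  ext G
  simp only [hfaces, Set.mem_image, ← Finset.coe_inj, Finset.coe_image, eq_comm]

end Runs

end PathComplexes.SimplicialComplex

open PathComplexes.SimplicialComplex in
theorem proposition4p4_general {K : Type*} [Field K] {V : Type*} [LinearOrder V]
    (l m s t : ℕ) (hm : m = t * l + s) (hs : s < l) (ht : 1 ≤ t)
    (α β : ℕ) (hαβ : 0 < α + β) (p : Fin α → ℕ) (q : Fin β → ℕ)
    (Γ : PathComplexes.SimplicialComplex V)
    (hΓ : Γ.IsDisjointUnionOfRuns m l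
      (Sum.elim (fun a => p a * (t + 1) + 1) (fun b => q b * (t + 1) + 2)))
    (i : ℤ) :
    (i = 2 * ((∑ a, (p a : ℤ)) + ∑ b, (q b : ℤ)) + 2 * (β : ℤ) + (α : ℤ) - 2 →
      Nonempty ((Γ.complement Γ.vertexSet).ReducedHomology K i ≃ₗ[K] K)) ∧
    (i ≠ 2 * ((∑ a, (p a : ℤ)) + ∑ b, (q b : ℤ)) + 2 * (β : ℤ) + (α : ℤ) - 2 →
      Subsingleton ((Γ.complement Γ.vertexSet).ReducedHomology K i)) := by
  obtain ⟨R, hR, hdisj, hfaces⟩ := hΓ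
  let n : Fin α ⊕ Fin β → ℕ := Sum.elim (fun a => 2 * p a + 1) (fun b => 2 * q b + 2)
  have hcol : ∀ j, (R j).FacetsCollapse (n j) := by
    rintro (a | b)
    · exact (hR (.inl a)).facetsCollapse (facetsCollapse_line_mul_add_one hm hs ht (p a))
    · exact (hR (.inr b)).facetsCollapse (facetsCollapse_line_mul_add_two hm hs ht (q b))
  have hsum : ∑ j, n j = 2 * (∑ a, p a + ∑ b, q b) + 2 * β + α := by
    simp only [n, Fintype.sum_sum_type, Sum.elim_inl, Sum.elim_inr, Finset.sum_add_distrib,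
      ← Finset.mul_sum, Finset.sum_const, Finset.card_univ, Fintype.card_fin, smul_eq_mul]
    ring
  have hconc := (FacetsCollapse.iUnion hdisj hfaces hcol).homologyConcentrated_complement (K := K)
    (by omega)
  rw [hsum] at hconc
  push_cast at hconc
  exact ⟨by rintro rfl; exact hconc.nonempty_equiv, fun hi => hconc.subsingleton hi.symm⟩

theorem proposition4p4 {K : Type*} [Field K] {V : Type*} [LinearOrder V]
    (l m s t : ℕ) (hm : m = t * l + s) (hs : s < l) (ht : 2 ≤ t)
    (α β : ℕ) (hαβ : 0 < α + β) (p : Fin α → ℕ) (q : Fin β → ℕ)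
    (Γ : PathComplexes.SimplicialComplex V)
    (hΓ : Γ.IsDisjointUnionOfRuns m l
      (Sum.elim (fun a => p a * (t + 1) + 1) (fun b => q b * (t + 1) + 2)))
    (i : ℤ) :
    (i = 2 * ((∑ a, (p a : ℤ)) + ∑ b, (q b : ℤ)) + 2 * (β : ℤ) + (α : ℤ) - 2 →
      Nonempty ((Γ.complement Γ.vertexSet).ReducedHomology K i ≃ₗ[K] K)) ∧
    (i ≠ 2 * ((∑ a, (p a : ℤ)) + ∑ b, (q b : ℤ)) + 2 * (β : ℤ) + (α : ℤ) - 2 →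
      Subsingleton ((Γ.complement Γ.vertexSet).ReducedHomology K i)) :=
  proposition4p4_general l m s t hm hs (by omega) α β hαβ p q Γ hΓ i
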